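/- Let $f:\mathbb R^p\times\mathbb R^q\to\mathbb R$ be a $C^4$ function whose derivatives of orders $1,\dots,4$ are bounded, let $\beta\in(-1,1)$ and let $T>0$ be a finite time horizon. For a step size $h>0$, call $(x_n,y_n)_{n\ge -1}$ a Sim-HB trajectory if for all $n\ge 0$ $$x_{n+1}=x_n-h\nabla_xf(x_n,y_n)+\beta(x_n-x_{n-1}),\qquad y_{n+1}=y_n+h\nabla_yf(x_n,y_n)+\beta(y_n-y_{n-1}),$$ and an Alt-HB trajectory if the same holds with $\nabla_yf(x_{n+1},y_n)$ in place of $\nabla_yf(x_n,y_n)$. Put $$\mathcal F(x,y)=\frac{1}{1-\beta}f(x,y)+\frac{h(1+\beta)}{4(1-\beta)^3}\left(\|\nabla_xf(x,y)\|^2-\|\nabla_yf(x,y)\|^2\right).$$ Continuous Sim-HB is the system $\dot x=-\nabla_x\mathcal F(x,y)$, $\dot y=\nabla_y\mathcal F(x,y)$; Continuous Alt-HB is the system $\dot x=-\nabla_x\mathcal F(x,y)$, $\dot y=\nabla_y\left(\mathcal F(x,y)-\frac{h}{2(1-\beta)^2}\|\nabla_xf(x,y)\|^2\right)$. Then Continuous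 Sim-HB (resp. Continuous Alt-HB) is locally $\mathcal O(h^3)$-close to Sim-HB (resp. Alt-HB) on $[0,T]$ after $4\log h/\log|\beta|$ steps. That is, for every $K$ there are constants $C$ and $h_0>0$, depending only on $f,\beta,T,K$, such that for all $0<h<h_0$: 1. for every $t_0\in[0,T]$ and every $(a,b)\in\mathbb R^p\times\mathbb R^q$ the continuous system has a solution on $[0,T]$ with $(x(t_0),y(t_0))=(a,b)$; 2. for every discrete trajectory with $\|x_0-x_{-1}\|\le K$ and $\|y_0-y_{-1}\|\le K$, every integer $n\ge 0$ with $n\ge 4\log h/\log|\beta|$ and $(n+1)h\le T$, and every solution $(x(t),y(t))$ of the continuous system on $[nh,(n+1)h]$ with $(x(nh),y(nh))=(x_n,y_n)$, $$\|x((n+1)h)-x_{n+1}\|\le C h^3\quad\text{and}\quad \|y((n+1)h)-y_{n+1}\|\le C h^3 .$$ (For $\beta=0$ the quotient $4\log h/\log|\beta|$ is read as $0$.) -/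

import Mathlib

noncomputable section

namespace HeavyBall

variable {E F : Type*}
  [NormedAddCommGroup E] [InnerProductSpace ℝ E] [CompleteSpace E]
  [NormedAddCommGroup F] [InnerProductSpace ℝ F] [CompleteSpace F]

/-- The partial gradient `∇ₓ f (x, y)`. -/
def gradX (f : E → F → ℝ) (x : E) (y : F) : E := gradient (fun u => f u y) x

/-- The partial gradient `∇_y f (x, y)`. -/
def gradY (f : E → F → ℝ) (x : E) (y : F) : F := gradient (fun v => f x v) y

/-- Simultaneous heavy ball with step size `h` and momentum `β`. The starting data are the points
with indices `-1` and `0`; values at indices below `-1` play no role. -/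
def IsSimHB (f : E → F → ℝ) (β h : ℝ) (x : ℤ → E) (y : ℤ → F) : Prop :=
  ∀ n : ℕ,
    x (n + 1) = x n - h • gradX f (x n) (y n) + β • (x n - x (n - 1)) ∧
    y (n + 1) = y n + h • gradY f (x n) (y n) + β • (y n - y (n - 1))

/-- Alternating heavy ball: the second player already sees `x (n + 1)`. -/
def IsAltHB (f : E → F → ℝ) (β h : ℝ) (x : ℤ → E) (y : ℤ → F) : Prop :=
  ∀ n : ℕ,
    x (n + 1) = x n - h • gradX f (x n) (y n) + β • (x n - x (n - 1)) ∧
    y (n + 1) = y n + h • gradY f (x (n + 1)) (y n) + β • (y n - y (n - 1))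

/-- The modified loss function. -/
def modifiedLoss (f : E → F → ℝ) (β h : ℝ) (x : E) (y : F) : ℝ :=
  1 / (1 - β) * f x y
    + h * (1 + β) / (4 * (1 - β) ^ 3) * (‖gradX f x y‖ ^ 2 - ‖gradY f x y‖ ^ 2)

/-- `(x, y)` solves the continuous-time model of simultaneous heavy ball on the time set `s`. -/
def IsContinuousSimHB (f : E → F → ℝ) (β h : ℝ) (x : ℝ → E) (y : ℝ → F) (s : Set ℝ) : Prop :=
  ∀ t ∈ s,
    HasDerivWithinAt x (-gradX (modifiedLoss f β h) (x t) (y t)) s t ∧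
    HasDerivWithinAt y (gradY (modifiedLoss f β h) (x t) (y t)) s t

/-- `(x, y)` solves the continuous-time model of alternating heavy ball on the time set `s`. -/
def IsContinuousAltHB (f : E → F → ℝ) (β h : ℝ) (x : ℝ → E) (y : ℝ → F) (s : Set ℝ) : Prop :=
  ∀ t ∈ s,
    HasDerivWithinAt x (-gradX (modifiedLoss f β h) (x t) (y t)) s t ∧
    HasDerivWithinAt y
      (gradY (fun u v => modifiedLoss f β h u v - h / (2 * (1 - β) ^ 2) * ‖gradX f u v‖ ^ 2)
        (x t) (y t)) s t

/-- The flow (with parameter `h`) is locally `O(h³)`-close to the discrete trajectories (with step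
size `h`) on `[0, T]` after `4 log h / log |β|` steps. Through every point at every time there is a
solution of the flow on `[0, T]`; and, with `t_n = n h`, a solution that agrees with a discrete
trajectory at time `t_n` is within `C h³` of it at time `t_{n+1}`, for all `n` past the burn-in and
`t_{n+1} ≤ T`. The constant `C` is uniform in `h`, `n`, the solution and the discrete trajectory, as
long as the initial displacement of the latter is at most `K`.
For `β = 0` the number of burn-in steps is `0`, in agreement with `Real.log 0 = 0`, `a / 0 = 0`. -/
def LocallyCubicClose
    (flow : (h : ℝ) → (ℝ → E) → (ℝ → F) → Set ℝ → Prop)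
    (discrete : (h : ℝ) → (ℤ → E) → (ℤ → F) → Prop) (β T : ℝ) : Prop :=
  ∀ K : ℝ, ∃ C h₀ : ℝ, 0 < h₀ ∧ ∀ h : ℝ, 0 < h → h < h₀ →
    (∀ t₀ ∈ Set.Icc 0 T, ∀ (a : E) (b : F), ∃ (x : ℝ → E) (y : ℝ → F),
      flow h x y (Set.Icc 0 T) ∧ x t₀ = a ∧ y t₀ = b) ∧
    ∀ (X : ℤ → E) (Y : ℤ → F), discrete h X Y →
      ‖X 0 - X (-1)‖ ≤ K → ‖Y 0 - Y (-1)‖ ≤ K →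
      ∀ n : ℕ, 4 * Real.log h / Real.log |β| ≤ n → (n + 1) * h ≤ T →
        ∀ (x : ℝ → E) (y : ℝ → F), flow h x y (Set.Icc (n * h) ((n + 1) * h)) →
          x (n * h) = X n → y (n * h) = Y n →
          ‖x ((n + 1) * h) - X (n + 1)‖ ≤ C * h ^ 3 ∧
          ‖y ((n + 1) * h) - Y (n + 1)‖ ≤ C * h ^ 3

end HeavyBall

end

/-!
With `v = (-∇ₓf, ∇_yf)` both schemes read `d' = β d + h (v + …)` for the displacement `d` from one
iterate to the next. The residual of a formal expansion of `d` in powers of `h` obeys a recursion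
that contracts by `β`. Hence, order by order, `d = h (1-β)⁻¹ v + h² c + O(h³)` up to a transient
decaying like a power of `|β|`, where `c` combines `Dv · v` and, for alternating updates, the part
of `Dv · v` through which the second player sees the move of the first. The gradients of `‖∇ₓf‖²`
and `‖∇_yf‖²` are built from the same vectors, and the weights in the modified loss are those for
which the Taylor expansion of the flow over a time step `h` agrees with `d` to second order.
-/

noncomputable section

namespace HeavyBall

open Asymptotics Filter Set
open scoped InnerProductSpace

/-! ### Bounded Lipschitz maps -/

section BoundedLipschitz

variable {V W X : Type*} [NormedAddCommGroup V] [NormedAddCommGroup W] [NormedAddCommGroup X]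
  {ι : Type*} {l : Filter ι}

theorem isBigO_clm_apply [NormedSpace ℝ W] [NormedSpace ℝ X] {A : ι → W →L[ℝ] X} {x : ι → W}
    {a b : ι → ℝ} (hA : A =O[l] a) (hx : x =O[l] b) :
    (fun i => A i (x i)) =O[l] fun i => a i * b i :=
  (IsBigO.of_norm_le fun i => (A i).le_opNorm (x i)).trans (hA.norm_left.mul hx.norm_left)

/-- Bounded Lipschitz maps. Domination along the filter `⊤` means domination with one constant at
all points, so the two fields are a uniform bound and a global Lipschitz estimate. -/
structure IsBoundedLipschitz (g : V → W) : Prop where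
  isBigO_one : g =O[⊤] fun _ => (1 : ℝ)
  isBigO_sub : (fun p : V × V => g p.1 - g p.2) =O[⊤] fun p => p.1 - p.2

namespace IsBoundedLipschitz

variable {g g' : V → W}

theorem comp_isBigO_one (hg : IsBoundedLipschitz g) (x : ι → V) :
    (fun i => g (x i)) =O[l] fun _ => (1 : ℝ) :=
  hg.isBigO_one.comp_tendsto tendsto_top

theorem comp_isBigO_sub (hg : IsBoundedLipschitz g) (x y : ι → V) :
    (fun i => g (x i) - g (y i)) =O[l] fun i => x i - y i :=
  hg.isBigO_sub.comp_tendsto (k := fun i => (x i, y i)) tendsto_top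

theorem add (hg : IsBoundedLipschitz g) (hg' : IsBoundedLipschitz g') :
    IsBoundedLipschitz fun z => g z + g' z where
  isBigO_one := hg.isBigO_one.add hg'.isBigO_one
  isBigO_sub := (hg.isBigO_sub.add hg'.isBigO_sub).congr_left fun _ => by abel

variable [NormedSpace ℝ W] [NormedSpace ℝ X]

theorem clm_comp (A : W →L[ℝ] X) (hg : IsBoundedLipschitz g) :
    IsBoundedLipschitz fun z => A (g z) where
  isBigO_one := (A.isBigO_comp g _).trans hg.isBigO_one
  isBigO_sub := ((A.isBigO_comp _ _).trans hg.isBigO_sub).congr_left fun _ => A.map_sub _ _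

theorem const_smul (c : ℝ) (hg : IsBoundedLipschitz g) : IsBoundedLipschitz fun z => c • g z :=
  hg.clm_comp (c • ContinuousLinearMap.id ℝ W)

theorem clm_apply {A : V → W →L[ℝ] X} (hA : IsBoundedLipschitz A) (hg : IsBoundedLipschitz g) :
    IsBoundedLipschitz fun z => A z (g z) where
  isBigO_one := by simpa using isBigO_clm_apply hA.isBigO_one hg.isBigO_one
  isBigO_sub := by
    have hfst := isBigO_clm_apply hA.isBigO_sub.norm_right (hg.comp_isBigO_one Prod.fst)
    have hsnd := isBigO_clm_apply (hA.comp_isBigO_one Prod.snd) hg.isBigO_sub.norm_right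
    simp only [mul_one, one_mul] at hfst hsnd
    exact (hfst.add hsnd).of_norm_right.congr_left fun p => by simp

variable [NormedSpace ℝ V]

theorem of_fderiv (hg : Differentiable ℝ g) (h₀ : g =O[⊤] fun _ => (1 : ℝ))
    (h₁ : fderiv ℝ g =O[⊤] fun _ => (1 : ℝ)) : IsBoundedLipschitz g where
  isBigO_one := h₀
  isBigO_sub := by
    obtain ⟨C, hC⟩ := isBigO_top.1 h₁
    refine isBigO_top.2 ⟨C, fun p => convex_univ.norm_image_sub_le_of_norm_fderiv_le
      (fun x _ => hg x) (fun x _ => ?_) (mem_univ p.2) (mem_univ p.1)⟩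
    simpa using hC x

theorem exists_solution [CompleteSpace V] {g : V → V} (hg : IsBoundedLipschitz g) {a b t₀ : ℝ}
    (ht₀ : t₀ ∈ Icc a b) (z₀ : V) :
    ∃ z : ℝ → V, z t₀ = z₀ ∧ ∀ t ∈ Icc a b, HasDerivWithinAt z (g (z t)) (Icc a b) t := by
  obtain ⟨M, hM⟩ := isBigO_top.1 hg.isBigO_one
  obtain ⟨K, hK⟩ := isBigO_top.1 hg.isBigO_sub
  have hpl : IsPicardLindelof (fun _ => g) (⟨t₀, ht₀⟩ : Icc a b) z₀
      (M.toNNReal * (b - a).toNNReal) 0 M.toNNReal K.toNNReal :=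
    { lipschitzOnWith := fun _ _ => (LipschitzWith.of_dist_le' fun z w => by
        simpa only [dist_eq_norm] using hK (z, w)).lipschitzOnWith
      continuousOn := fun _ _ => continuousOn_const
      norm_le := fun _ _ z _ => (hM z).trans (by simp)
      mul_max_le := by
        rw [NNReal.coe_zero, sub_zero, NNReal.coe_mul,
          Real.coe_toNNReal (b - a) (sub_nonneg.2 (ht₀.1.trans ht₀.2))]
        exact mul_le_mul_of_nonneg_left
          (max_le (sub_le_sub_left ht₀.1 b) (sub_le_sub_right ht₀.2 a)) (NNReal.coe_nonneg _) }
  exact hpl.exists_eq_forall_mem_Icc_hasDerivWithinAt₀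

end IsBoundedLipschitz

variable [NormedSpace ℝ V] [NormedSpace ℝ W] [NormedSpace ℝ X]

/-- Differentiable maps that are bounded and have a bounded Lipschitz derivative: the regularity of
the vector fields to which the expansions below apply. -/
structure IsBoundedC11 (v : V → W) : Prop where
  differentiable : Differentiable ℝ v
  isBoundedLipschitz : IsBoundedLipschitz v
  isBoundedLipschitz_fderiv : IsBoundedLipschitz (fderiv ℝ v)

namespace IsBoundedC11

variable {v : V → W}

theorem clm_comp (A : W →L[ℝ] X) (hv : IsBoundedC11 v) : IsBoundedC11 fun z => A (v z) where
  differentiable := A.differentiable.comp hv.differentiable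
  isBoundedLipschitz := hv.isBoundedLipschitz.clm_comp A
  isBoundedLipschitz_fderiv := by
    have h : fderiv ℝ (fun z => A (v z)) = fun z => A ∘L fderiv ℝ v z :=
      funext fun z => (A.hasFDerivAt.comp z (hv.differentiable z).hasFDerivAt).fderiv
    exact h ▸ hv.isBoundedLipschitz_fderiv.clm_comp (.compL ℝ V W X A)

theorem const_smul (c : ℝ) (hv : IsBoundedC11 v) : IsBoundedC11 fun z => c • v z :=
  hv.clm_comp (c • ContinuousLinearMap.id ℝ W)

theorem taylor_isBigO (hv : IsBoundedC11 v) (x d : ι → V) :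
    (fun i => v (x i + d i) - v (x i) - fderiv ℝ v (x i) (d i)) =O[l] fun i => ‖d i‖ ^ 2 := by
  obtain ⟨C, hC₀, hC⟩ := hv.isBoundedLipschitz_fderiv.isBigO_sub.exists_nonneg
  rw [isBigOWith_top] at hC
  refine .of_bound C (.of_forall fun i => ?_)
  have h := (convex_closedBall (x i) ‖d i‖).norm_image_sub_le_of_norm_fderiv_le'
    (f := v) (φ := fderiv ℝ v (x i)) (x := x i) (y := x i + d i) (C := C * ‖d i‖)
    (fun y _ => hv.differentiable y)
    (fun y hy => (hC (y, x i)).trans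
      (mul_le_mul_of_nonneg_left (mem_closedBall_iff_norm.1 hy) hC₀)) (by simp) (by simp)
  simpa [sq, mul_assoc] using h

end IsBoundedC11

end BoundedLipschitz

/-! ### Heavy ball trajectories -/

section Discrete

theorem le_of_geometric_recursion {u : ℕ → ℝ} {θ σ ε C : ℝ} (hθ : θ ∈ Ico 0 1) (hσ : σ ∈ Icc 0 1)
    (hε : 0 ≤ ε) (h₀ : u 0 ≤ C) (hC : 0 ≤ C)
    (hu : ∀ n, u (n + 1) ≤ θ * σ * u n + C * (ε + σ ^ (n + 1))) (n : ℕ) :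
    u n ≤ C / (1 - θ) * (ε + σ ^ n) := by
  have hθ' : 0 < 1 - θ := sub_pos.2 hθ.2
  set D := C / (1 - θ)
  have hD : D = θ * D + C := by simp only [D]; field_simp; ring
  have hD₀ : 0 ≤ D := div_nonneg hC hθ'.le
  induction n with
  | zero =>
    have h₁ : 0 ≤ θ * D + D * ε := add_nonneg (mul_nonneg hθ.1 hD₀) (mul_nonneg hD₀ hε)
    rw [pow_zero, mul_add, mul_one]
    linarith
  | succ n ih =>
    calc u (n + 1) ≤ θ * σ * u n + C * (ε + σ ^ (n + 1)) := hu n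
      _ ≤ θ * σ * (D * (ε + σ ^ n)) + C * (ε + σ ^ (n + 1)) := by
        gcongr
        exact mul_nonneg hθ.1 hσ.1
      _ = θ * D * (σ * ε + σ ^ (n + 1)) + C * (ε + σ ^ (n + 1)) := by ring
      _ ≤ θ * D * (ε + σ ^ (n + 1)) + C * (ε + σ ^ (n + 1)) := by
        gcongr
        · exact mul_nonneg hθ.1 hD₀
        · exact mul_le_of_le_one_left hε hσ.2
      _ = D * (ε + σ ^ (n + 1)) := by rw [← add_mul, ← hD]

variable {V : Type*} [NormedAddCommGroup V] [NormedSpace ℝ V]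
  {W : Type*} [NormedAddCommGroup W] {ι : Type*} {h : ι → ℝ} {β θ : ℝ} {k : ℕ}

/-- The size `h ^ k + θ ^ (3 n)` of an error of order `k` at step `n`, the second summand being the
transient left over from the initial data. With `|β| = θ ^ 4` the transient decays more slowly than
`|β| ^ n`, so that the recursions below preserve it, and still reaches `h ^ 3` when `|β| ^ n`
reaches `h ^ 4`. -/
def errorScale (h : ι → ℝ) (θ : ℝ) (k : ℕ) (p : ι × ℕ) : ℝ :=
  h p.1 ^ k + (θ ^ 3) ^ p.2

theorem one_sub_ne_zero (hθ : θ ∈ Ico 0 1) (hβ : |β| = θ ^ 4) : 1 - β ≠ 0 :=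
  sub_ne_zero.2 fun h => (pow_lt_one₀ hθ.1 hθ.2 four_ne_zero).ne (by rw [← hβ, ← h, abs_one])

theorem errorScale_nonneg (hh : ∀ i, h i ∈ Icc (0 : ℝ) 1) (hθ : 0 ≤ θ) (p : ι × ℕ) :
    0 ≤ errorScale h θ k p :=
  add_nonneg (pow_nonneg (hh p.1).1 k) (by positivity)

theorem smul_isBigO_errorScale (hh : ∀ i, h i ∈ Icc (0 : ℝ) 1) (hθ : 0 ≤ θ) {f : ι × ℕ → V}
    (hf : f =O[⊤] errorScale h θ k) : (fun p => h p.1 • f p) =O[⊤] errorScale h θ (k + 1) := by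
  refine ((isBigO_refl (fun p : ι × ℕ => h p.1) ⊤).smul hf).trans (.of_norm_le fun p => ?_)
  obtain ⟨hp₀, hp₁⟩ := hh p.1
  rw [smul_eq_mul, Real.norm_of_nonneg (mul_nonneg hp₀ (errorScale_nonneg hh hθ p)), errorScale,
    mul_add, ← pow_succ']
  exact add_le_add_right (mul_le_of_le_one_left (by positivity) hp₁) _

theorem errorScale_one_sq_isBigO (hh : ∀ i, h i ∈ Icc (0 : ℝ) 1) (hθ : θ ∈ Ico 0 1) :
    (fun p => errorScale h θ 1 p ^ 2) =O[⊤] errorScale h θ 2 := by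
  refine isBigO_top.2 ⟨2, fun p => ?_⟩
  have hτ₀ : 0 ≤ (θ ^ 3) ^ p.2 := by have := hθ.1; positivity
  have hτ₁ : (θ ^ 3) ^ p.2 ≤ 1 := pow_le_one₀ (pow_nonneg hθ.1 3) (pow_le_one₀ hθ.1 hθ.2.le)
  rw [Real.norm_of_nonneg (sq_nonneg _), Real.norm_of_nonneg (errorScale_nonneg hh hθ.1 p)]
  calc (h p.1 ^ 1 + (θ ^ 3) ^ p.2) ^ 2 ≤ 2 * ((h p.1 ^ 1) ^ 2 + ((θ ^ 3) ^ p.2) ^ 2) := add_sq_le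
    _ ≤ 2 * (h p.1 ^ 2 + (θ ^ 3) ^ p.2) := by
      rw [pow_one]
      gcongr
      exact pow_le_of_le_one hτ₀ hτ₁ two_ne_zero

theorem abs_mul_errorScale_le (hh : ∀ i, h i ∈ Icc (0 : ℝ) 1) (hθ : θ ∈ Ico 0 1)
    (hβ : |β| = θ ^ 4) (i : ι) (n : ℕ) :
    |β| * errorScale h θ k (i, n) ≤ errorScale h θ k (i, n + 1) := by
  have hβ₁ : |β| ≤ 1 := hβ ▸ pow_le_one₀ hθ.1 hθ.2.le
  have hβσ : |β| ≤ θ ^ 3 := hβ ▸ pow_le_pow_of_le_one hθ.1 hθ.2.le (by norm_num)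
  rw [errorScale, errorScale, mul_add, pow_succ' (θ ^ 3) n]
  have := hθ.1
  gcongr
  exact mul_le_of_le_one_left (pow_nonneg (hh i).1 k) hβ₁

theorem isBigO_errorScale_of_recursion (hh : ∀ i, h i ∈ Icc (0 : ℝ) 1) (hθ : θ ∈ Ico 0 1)
    (hβ : |β| = θ ^ 4) {u f g : ι × ℕ → V} (h₀ : (fun i => u (i, 0)) =O[⊤] fun _ => (1 : ℝ))
    (hf : f =O[⊤] errorScale h θ k) (hg : g =O[⊤] errorScale h θ k)
    (hu : ∀ i n, u (i, n + 1) = β • (u (i, n) + f (i, n)) + g (i, n + 1)) :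
    u =O[⊤] errorScale h θ k := by
  have hscale₀ (p : ι × ℕ) : 0 ≤ errorScale h θ k p := errorScale_nonneg hh hθ.1 p
  obtain ⟨A, hA, h₀⟩ := h₀.exists_nonneg
  obtain ⟨M, hM, hf⟩ := hf.exists_nonneg
  obtain ⟨N, hN, hg⟩ := hg.exists_nonneg
  simp only [isBigOWith_top, norm_one, mul_one, Real.norm_of_nonneg (hscale₀ _)] at h₀ hf hg
  have hσ : θ ^ 3 ∈ Icc (0 : ℝ) 1 := ⟨pow_nonneg hθ.1 3, pow_le_one₀ hθ.1 hθ.2.le⟩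
  refine isBigO_top.2 ⟨(A + M + N) / (1 - θ), fun ⟨i, n⟩ => ?_⟩
  rw [Real.norm_of_nonneg (hscale₀ _)]
  refine le_of_geometric_recursion (u := fun n => ‖u (i, n)‖) hθ hσ (pow_nonneg (hh i).1 k)
    ((h₀ i).trans (by linarith)) (by positivity) (fun n => ?_) n
  have hβf : |β| * ‖f (i, n)‖ ≤ M * errorScale h θ k (i, n + 1) :=
    calc |β| * ‖f (i, n)‖ ≤ |β| * (M * errorScale h θ k (i, n)) := by gcongr; exact hf (i, n)
      _ = M * (|β| * errorScale h θ k (i, n)) := mul_left_comm ..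
      _ ≤ M * errorScale h θ k (i, n + 1) := by
        gcongr
        exact abs_mul_errorScale_le hh hθ hβ i n
  have hA' : 0 ≤ A * errorScale h θ k (i, n + 1) := mul_nonneg hA (hscale₀ _)
  calc ‖u (i, n + 1)‖ ≤ |β| * ‖u (i, n)‖ + |β| * ‖f (i, n)‖ + ‖g (i, n + 1)‖ := by
        rw [hu, smul_add]
        exact norm_add₃_le.trans_eq (by simp only [norm_smul, Real.norm_eq_abs])
    _ ≤ |β| * ‖u (i, n)‖ + (A + M + N) * errorScale h θ k (i, n + 1) := by
        linarith [hg (i, n + 1)]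
    _ = θ * θ ^ 3 * ‖u (i, n)‖ + (A + M + N) * errorScale h θ k (i, n + 1) := by
        rw [hβ, pow_succ' θ 3]

/-- Heavy ball with step size `h` and momentum `β` for the vector field `v`, where the components
selected by `Q` already see the new value of the components selected by `P`; for `Q = 0` all
components are updated simultaneously. The starting data are `z 0` and `z 1`, so `z n` is the
iterate with index `n - 1` of the paper. -/
def IsHeavyBall (v : V → V) (P Q : V →L[ℝ] V) (β h : ℝ) (z : ℕ → V) : Prop :=
  ∀ n, z (n + 2) = z (n + 1) + β • (z (n + 1) - z n) +
    h • (v (z (n + 1)) + Q (v (z (n + 1) + P (z (n + 2) - z (n + 1))) - v (z (n + 1))))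

/-- The part of second order in `h` of heavy ball displacements and of their continuous models, for
various coefficients `b` and `c`; the term with `Q` and `P` is due to alternating updates. -/
def correction (v : V → V) (P Q : V →L[ℝ] V) (b c : ℝ) (z : V) : V :=
  b • fderiv ℝ v z (v z) + c • Q (fderiv ℝ v z (P (v z)))

/-- The error of the first order expansion `h / (1 - β) • v` of the displacement of heavy ball. -/
def firstResidual (v : V → V) (β h : ℝ) (z : ℕ → V) (n : ℕ) : V :=
  z (n + 1) - z n - h • (1 - β)⁻¹ • v (z n)

/-- The error of the second order expansion of the displacement of heavy ball. -/
def secondResidual (v : V → V) (P Q : V →L[ℝ] V) (β h : ℝ) (z : ℕ → V) (n : ℕ) : V :=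
  firstResidual v β h z n
    - h ^ 2 • correction v P Q (-β * (1 - β)⁻¹ ^ 3) ((1 - β)⁻¹ ^ 2) (z n)

variable {v : V → V} {P Q : V →L[ℝ] V}

theorem IsBoundedC11.isBoundedLipschitz_correction (hv : IsBoundedC11 v) (P Q : V →L[ℝ] V)
    (b c : ℝ) : IsBoundedLipschitz (correction v P Q b c) :=
  have hv₀ := hv.isBoundedLipschitz
  have hv₁ := hv.isBoundedLipschitz_fderiv
  ((hv₁.clm_apply hv₀).const_smul b).add
    (((hv₁.clm_apply (hv₀.clm_comp P)).clm_comp Q).const_smul c)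

theorem IsHeavyBall.firstResidual_succ {h : ℝ} {z : ℕ → V} (hβ : 1 - β ≠ 0)
    (hz : IsHeavyBall v P Q β h z) (n : ℕ) :
    firstResidual v β h z (n + 1) =
      β • (firstResidual v β h z n + h • (1 - β)⁻¹ • (v (z n) - v (z (n + 1))))
        + h • Q (v (z (n + 1) + P (z (n + 2) - z (n + 1))) - v (z (n + 1))) := by
  have hsplit : h • v (z (n + 1)) = (h * (1 - β)⁻¹ * (1 - β)) • v (z (n + 1)) := by
    rw [inv_mul_cancel_right₀ hβ]
  simp only [firstResidual]
  linear_combination (norm := module) hz n + hsplit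

theorem IsHeavyBall.secondResidual_succ {h : ℝ} {z : ℕ → V} (hβ : 1 - β ≠ 0)
    (hz : IsHeavyBall v P Q β h z) (n : ℕ) :
    secondResidual v P Q β h z (n + 1) =
      β • (secondResidual v P Q β h z n + (h • (1 - β)⁻¹ •
          (v (z n) - v (z (n + 1)) +
            h • (1 - β)⁻¹ • fderiv ℝ v (z (n + 1)) (v (z (n + 1))))
        + h • h • (correction v P Q (-β * (1 - β)⁻¹ ^ 3) ((1 - β)⁻¹ ^ 2) (z n)
          - correction v P Q (-β * (1 - β)⁻¹ ^ 3) ((1 - β)⁻¹ ^ 2) (z (n + 1)))))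
      + h • Q (v (z (n + 1) + P (z (n + 2) - z (n + 1))) - v (z (n + 1)) -
          h • (1 - β)⁻¹ • fderiv ℝ v (z (n + 1)) (P (v (z (n + 1))))) := by
  have hc : h ^ 2 • (1 - β) • correction v P Q (-β * (1 - β)⁻¹ ^ 3) ((1 - β)⁻¹ ^ 2) (z (n + 1)) =
      h ^ 2 • correction v P Q (-β * (1 - β)⁻¹ ^ 2) (1 - β)⁻¹ (z (n + 1)) := by
    simp only [correction]
    match_scalars <;> field_simp
  simp only [secondResidual, hz.firstResidual_succ hβ, map_sub, map_smul]
  simp only [correction] at hc ⊢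
  linear_combination (norm := module) -hc

/-- A family of heavy ball trajectories with step sizes at most `1` and bounded initial
displacements. Estimates along the filter `⊤` on `ι × ℕ` are uniform over the family and in time. -/
structure IsHeavyBallFamily (v : V → V) (P Q : V →L[ℝ] V) (β : ℝ) (h : ι → ℝ) (z : ι → ℕ → V) :
    Prop where
  step_mem : ∀ i, h i ∈ Icc (0 : ℝ) 1
  isHeavyBall : ∀ i, IsHeavyBall v P Q β (h i) (z i)
  initial_isBigO : (fun i => z i 1 - z i 0) =O[⊤] fun _ => (1 : ℝ)

namespace IsHeavyBallFamily

variable {z : ι → ℕ → V}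

theorem step_isBigO_one (hz : IsHeavyBallFamily v P Q β h z) : h =O[⊤] fun _ => (1 : ℝ) :=
  .of_norm_le fun i => (Real.norm_of_nonneg (hz.step_mem i).1).trans_le (hz.step_mem i).2

theorem displacement_isBigO (hz : IsHeavyBallFamily v P Q β h z) (hv : IsBoundedLipschitz v)
    (hθ : θ ∈ Ico 0 1) (hβ : |β| = θ ^ 4) :
    (fun p : ι × ℕ => z p.1 (p.2 + 1) - z p.1 p.2) =O[⊤] errorScale h θ 1 := by
  have hforce : (fun p : ι × ℕ => v (z p.1 p.2)
      + Q (v (z p.1 p.2 + P (z p.1 (p.2 + 1) - z p.1 p.2)) - v (z p.1 p.2))) =O[⊤]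
      errorScale h θ 0 := by
    have hone : (fun _ => (1 : ℝ)) =O[⊤] errorScale h θ 0 := .of_norm_le fun p => by
      have := hθ.1
      rw [norm_one, errorScale, pow_zero]
      exact le_add_of_nonneg_right (by positivity)
    exact ((hv.comp_isBigO_one _).add ((Q.isBigO_comp _ _).trans
      ((hv.comp_isBigO_one _).sub (hv.comp_isBigO_one _)))).trans hone
  refine isBigO_errorScale_of_recursion hz.step_mem hθ hβ (f := 0) hz.initial_isBigO
    (isBigO_zero _ _) (smul_isBigO_errorScale hz.step_mem hθ.1 hforce) fun i n => ?_
  rw [Pi.zero_apply, add_zero]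
  linear_combination (norm := module) hz.isHeavyBall i n

theorem sub_succ_isBigO (hz : IsHeavyBallFamily v P Q β h z) (hv : IsBoundedLipschitz v)
    (hθ : θ ∈ Ico 0 1) (hβ : |β| = θ ^ 4) {g : V → W} (hg : IsBoundedLipschitz g) :
    (fun p : ι × ℕ => g (z p.1 p.2) - g (z p.1 (p.2 + 1))) =O[⊤] errorScale h θ 1 :=
  (hg.comp_isBigO_sub _ _).trans
    ((hz.displacement_isBigO hv hθ hβ).neg_left.congr_left fun _ => neg_sub _ _)

theorem firstResidual_isBigO (hz : IsHeavyBallFamily v P Q β h z) (hv : IsBoundedLipschitz v)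
    (hθ : θ ∈ Ico 0 1) (hβ : |β| = θ ^ 4) :
    (fun p : ι × ℕ => firstResidual v β (h p.1) (z p.1) p.2) =O[⊤] errorScale h θ 2 := by
  have hd := hz.displacement_isBigO hv hθ hβ
  have hinit : (fun i => firstResidual v β (h i) (z i) 0) =O[⊤] fun _ => (1 : ℝ) := by
    have hv₀ := (hv.comp_isBigO_one (l := ⊤) fun i => z i 0).const_smul_left (1 - β)⁻¹
    have hstep := hz.step_isBigO_one.smul hv₀
    simp only [one_smul] at hstep
    exact hz.initial_isBigO.sub hstep
  have hback : (fun p : ι × ℕ => h p.1 • (1 - β)⁻¹ • (v (z p.1 p.2) - v (z p.1 (p.2 + 1))))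
      =O[⊤] errorScale h θ 2 :=
    smul_isBigO_errorScale hz.step_mem hθ.1
      ((hz.sub_succ_isBigO hv hθ hβ hv).const_smul_left (1 - β)⁻¹)
  have hforward : (fun p : ι × ℕ => v (z p.1 p.2 + P (z p.1 (p.2 + 1) - z p.1 p.2)) - v (z p.1 p.2))
      =O[⊤] errorScale h θ 1 :=
    (hv.comp_isBigO_sub _ _).trans <| ((P.isBigO_comp _ _).trans hd).congr_left fun _ =>
      (add_sub_cancel_left _ _).symm
  exact isBigO_errorScale_of_recursion hz.step_mem hθ hβ hinit hback
    (smul_isBigO_errorScale hz.step_mem hθ.1 ((Q.isBigO_comp _ _).trans hforward))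
    fun i n => (hz.isHeavyBall i).firstResidual_succ (one_sub_ne_zero hθ hβ) n

theorem forward_expansion_isBigO (hz : IsHeavyBallFamily v P Q β h z) (hv : IsBoundedC11 v)
    (hθ : θ ∈ Ico 0 1) (hβ : |β| = θ ^ 4) :
    (fun p : ι × ℕ => v (z p.1 p.2 + P (z p.1 (p.2 + 1) - z p.1 p.2)) - v (z p.1 p.2)
      - h p.1 • (1 - β)⁻¹ • fderiv ℝ v (z p.1 p.2) (P (v (z p.1 p.2)))) =O[⊤]
      errorScale h θ 2 := by
  have hv₀ := hv.isBoundedLipschitz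
  have hPd := (P.isBigO_comp _ _).trans (hz.displacement_isBigO hv₀ hθ hβ)
  have htaylor := (hv.taylor_isBigO (fun p : ι × ℕ => z p.1 p.2) _).trans
    ((hPd.norm_left.pow 2).trans (errorScale_one_sq_isBigO hz.step_mem hθ))
  have hresidual := isBigO_clm_apply
    (hv.isBoundedLipschitz_fderiv.comp_isBigO_one fun p : ι × ℕ => z p.1 p.2)
    ((P.isBigO_comp _ _).trans (hz.firstResidual_isBigO hv₀ hθ hβ))
  simp only [one_mul] at hresidual
  refine (htaylor.add hresidual).congr_left fun p => ?_
  simp only [firstResidual, map_sub, map_smul]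
  abel

theorem backward_expansion_isBigO (hz : IsHeavyBallFamily v P Q β h z) (hv : IsBoundedC11 v)
    (hθ : θ ∈ Ico 0 1) (hβ : |β| = θ ^ 4) :
    (fun p : ι × ℕ => v (z p.1 p.2) - v (z p.1 (p.2 + 1))
      + h p.1 • (1 - β)⁻¹ • fderiv ℝ v (z p.1 (p.2 + 1)) (v (z p.1 (p.2 + 1)))) =O[⊤]
      errorScale h θ 2 := by
  have hv₀ := hv.isBoundedLipschitz
  have hv₁ := hv.isBoundedLipschitz_fderiv.comp_isBigO_one (l := ⊤)
    fun p : ι × ℕ => z p.1 (p.2 + 1)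
  have hd := (hz.displacement_isBigO hv₀ hθ hβ).neg_left
  have htaylor := (hv.taylor_isBigO (fun p : ι × ℕ => z p.1 (p.2 + 1)) _).trans
    ((hd.norm_left.pow 2).trans (errorScale_one_sq_isBigO hz.step_mem hθ))
  have hresidual := isBigO_clm_apply hv₁ (hz.firstResidual_isBigO hv₀ hθ hβ)
  have hvariation := isBigO_clm_apply hv₁ (hz.sub_succ_isBigO hv₀ hθ hβ hv₀)
  simp only [one_mul] at hresidual hvariation
  refine ((htaylor.sub hresidual).sub (smul_isBigO_errorScale hz.step_mem hθ.1
    (hvariation.const_smul_left (1 - β)⁻¹))).congr_left fun p => ?_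
  simp only [firstResidual, Pi.smul_apply, map_sub, map_smul, neg_sub, add_sub_cancel]
  module

theorem secondResidual_isBigO (hz : IsHeavyBallFamily v P Q β h z) (hv : IsBoundedC11 v)
    (hθ : θ ∈ Ico 0 1) (hβ : |β| = θ ^ 4) :
    (fun p : ι × ℕ => secondResidual v P Q β (h p.1) (z p.1) p.2) =O[⊤] errorScale h θ 3 := by
  have hv₀ := hv.isBoundedLipschitz
  have hcorr := hv.isBoundedLipschitz_correction P Q (-β * (1 - β)⁻¹ ^ 3) ((1 - β)⁻¹ ^ 2)
  have hinit : (fun i => secondResidual v P Q β (h i) (z i) 0) =O[⊤] fun _ => (1 : ℝ) := by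
    have hfirst := (hz.firstResidual_isBigO hv₀ hθ hβ).comp_tendsto (k := fun i => (i, 0))
      (tendsto_top (l := ⊤))
    have hscale : (errorScale h θ 2 ∘ fun i => (i, 0)) =O[⊤] fun _ => (1 : ℝ) := by
      simpa [errorScale, Function.comp_def] using
        (hz.step_isBigO_one.pow 2).add (isBigO_refl (fun _ => (1 : ℝ) ^ 2) ⊤)
    have hsecond := (hz.step_isBigO_one.pow 2).smul (hcorr.comp_isBigO_one fun i => z i 0)
    simp only [one_pow, one_smul] at hsecond
    exact (hfirst.trans hscale).sub hsecond
  have hback := smul_isBigO_errorScale hz.step_mem hθ.1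
    ((hz.backward_expansion_isBigO hv hθ hβ).const_smul_left (1 - β)⁻¹)
  have hvariation := smul_isBigO_errorScale hz.step_mem hθ.1
    (smul_isBigO_errorScale hz.step_mem hθ.1 (hz.sub_succ_isBigO hv₀ hθ hβ hcorr))
  have hforward := smul_isBigO_errorScale hz.step_mem hθ.1
    ((Q.isBigO_comp _ _).trans (hz.forward_expansion_isBigO (P := P) hv hθ hβ))
  exact isBigO_errorScale_of_recursion hz.step_mem hθ hβ hinit (hback.add hvariation) hforward
    fun i n => (hz.isHeavyBall i).secondResidual_succ (one_sub_ne_zero hθ hβ) n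

end IsHeavyBallFamily

end Discrete

/-! ### Continuous flows -/

section Flow

variable {V : Type*} [NormedAddCommGroup V] [NormedSpace ℝ V] {ι : Type*} {h t₀ : ι → ℝ}
  {ζ : ι → ℝ → V}

/-- The pairs of a member of a family of flow lines and a time in its interval
`[t₀ i, t₀ i + h i]`. -/
def timeDomain (t₀ h : ι → ℝ) : Set (ι × ℝ) :=
  {q | q.2 ∈ Icc (t₀ q.1) (t₀ q.1 + h q.1)}

theorem sub_initial_isBigO_of_hasDerivWithinAt {ζ' : ι → ℝ → V} {k : ℕ}
    (hζ : ∀ i, ∀ t ∈ Icc (t₀ i) (t₀ i + h i),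
      HasDerivWithinAt (ζ i) (ζ' i t) (Icc (t₀ i) (t₀ i + h i)) t)
    (hζ' : (fun q : ι × ℝ => ζ' q.1 q.2) =O[𝓟 (timeDomain t₀ h)] fun q => h q.1 ^ k) :
    (fun q : ι × ℝ => ζ q.1 q.2 - ζ q.1 (t₀ q.1)) =O[𝓟 (timeDomain t₀ h)]
      fun q => h q.1 ^ (k + 1) := by
  obtain ⟨C, hC₀, hC⟩ := hζ'.exists_nonneg
  rw [isBigOWith_principal] at hC
  refine isBigO_principal.2 ⟨C, fun ⟨i, t⟩ ht => ?_⟩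
  have hh : t - t₀ i ≤ h i := sub_le_iff_le_add'.2 ht.2
  calc ‖ζ i t - ζ i (t₀ i)‖ ≤ C * ‖h i ^ k‖ * (t - t₀ i) :=
        norm_image_sub_le_of_norm_deriv_le_segment' (hζ i)
          (fun s hs => hC (i, s) (Ico_subset_Icc_self hs)) t ht
    _ ≤ C * ‖h i ^ k‖ * ‖h i‖ := by
        gcongr
        exact hh.trans (le_abs_self _)
    _ = C * ‖h i ^ (k + 1)‖ := by rw [pow_succ, norm_mul, mul_assoc]

/-- A family of flow lines of the vector fields `w + h i • p`, each on a time interval of length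
`h i ≤ 1`. -/
structure IsFlowFamily (w p : V → V) (h t₀ : ι → ℝ) (ζ : ι → ℝ → V) : Prop where
  step_mem : ∀ i, h i ∈ Icc (0 : ℝ) 1
  hasDerivWithinAt : ∀ i, ∀ t ∈ Icc (t₀ i) (t₀ i + h i),
    HasDerivWithinAt (ζ i) (w (ζ i t) + h i • p (ζ i t)) (Icc (t₀ i) (t₀ i + h i)) t

namespace IsFlowFamily

variable {w p : V → V}

theorem sub_initial_isBigO (hζ : IsFlowFamily w p h t₀ ζ) (hw : IsBoundedLipschitz w)
    (hp : IsBoundedLipschitz p) :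
    (fun q : ι × ℝ => ζ q.1 q.2 - ζ q.1 (t₀ q.1)) =O[𝓟 (timeDomain t₀ h)] fun q => h q.1 := by
  have hh : (fun q : ι × ℝ => h q.1) =O[𝓟 (timeDomain t₀ h)] fun _ => (1 : ℝ) :=
    .of_norm_le fun q => by
      rw [Real.norm_of_nonneg (hζ.step_mem q.1).1]
      exact (hζ.step_mem q.1).2
  have hhp := hh.smul (hp.comp_isBigO_one fun q : ι × ℝ => ζ q.1 q.2)
  simp only [one_smul] at hhp
  have hderiv := (hw.comp_isBigO_one fun q : ι × ℝ => ζ q.1 q.2).add hhp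
  simpa only [zero_add, pow_one] using sub_initial_isBigO_of_hasDerivWithinAt (k := 0)
    hζ.hasDerivWithinAt (by simpa only [pow_zero] using hderiv)

theorem first_order_isBigO (hζ : IsFlowFamily w p h t₀ ζ) (hw : IsBoundedLipschitz w)
    (hp : IsBoundedLipschitz p) :
    (fun q : ι × ℝ => ζ q.1 q.2 - ζ q.1 (t₀ q.1) - (q.2 - t₀ q.1) • w (ζ q.1 (t₀ q.1)))
      =O[𝓟 (timeDomain t₀ h)] fun q => h q.1 ^ 2 := by
  have hhp := (isBigO_refl (fun q : ι × ℝ => h q.1) (𝓟 (timeDomain t₀ h))).smul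
    (hp.comp_isBigO_one fun q : ι × ℝ => ζ q.1 q.2)
  simp only [smul_eq_mul, mul_one] at hhp
  have hderiv := ((hw.comp_isBigO_sub (fun q : ι × ℝ => ζ q.1 q.2) fun q => ζ q.1 (t₀ q.1)).trans
    (hζ.sub_initial_isBigO hw hp)).add hhp
  refine (sub_initial_isBigO_of_hasDerivWithinAt (k := 1)
    (ζ := fun i t => ζ i t - (t - t₀ i) • w (ζ i (t₀ i)))
    (fun i t ht => (hζ.hasDerivWithinAt i t ht).sub
      (((hasDerivWithinAt_id t _).sub_const (t₀ i)).smul_const (w (ζ i (t₀ i)))))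
    (hderiv.congr (fun q => ?_) fun q => (pow_one _).symm)).congr_left fun q => ?_
  · module
  · module

theorem second_order_isBigO (hζ : IsFlowFamily w p h t₀ ζ) (hw : IsBoundedC11 w)
    (hp : IsBoundedLipschitz p) :
    (fun i => ζ i (t₀ i + h i) - ζ i (t₀ i) - h i • w (ζ i (t₀ i))
        - h i ^ 2 • (p (ζ i (t₀ i)) + (2⁻¹ : ℝ) • fderiv ℝ w (ζ i (t₀ i)) (w (ζ i (t₀ i)))))
      =O[⊤] fun i => h i ^ 3 := by
  have hw₀ := hw.isBoundedLipschitz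
  have hsub := hζ.sub_initial_isBigO hw₀ hp
  have htaylor := (hw.taylor_isBigO (fun q : ι × ℝ => ζ q.1 (t₀ q.1)) _).trans
    (hsub.norm_left.pow 2)
  have hresidual := isBigO_clm_apply
    (hw.isBoundedLipschitz_fderiv.comp_isBigO_one fun q : ι × ℝ => ζ q.1 (t₀ q.1))
    (hζ.first_order_isBigO hw₀ hp)
  have hvariation := (isBigO_refl (fun q : ι × ℝ => h q.1) (𝓟 (timeDomain t₀ h))).smul
    ((hp.comp_isBigO_sub (fun q : ι × ℝ => ζ q.1 q.2) fun q => ζ q.1 (t₀ q.1)).trans hsub)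
  simp only [one_mul, smul_eq_mul, ← sq] at hresidual hvariation
  have hquadratic (i : ι) (t : ℝ) (s : Set ℝ) :
      HasDerivWithinAt (fun t => 2⁻¹ * (t - t₀ i) ^ 2) (t - t₀ i) s t := by
    refine ((((hasDerivWithinAt_id t s).sub_const (t₀ i)).pow 2).const_mul 2⁻¹).congr_deriv ?_
    simp
  have hexpansion := sub_initial_isBigO_of_hasDerivWithinAt (k := 2)
    (ζ := fun i t => ζ i t - (t - t₀ i) • (w (ζ i (t₀ i)) + h i • p (ζ i (t₀ i)))
      - (2⁻¹ * (t - t₀ i) ^ 2) • fderiv ℝ w (ζ i (t₀ i)) (w (ζ i (t₀ i))))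
    (fun i t ht => ((hζ.hasDerivWithinAt i t ht).sub
      (((hasDerivWithinAt_id t _).sub_const (t₀ i)).smul_const _)).sub
        ((hquadratic i t _).smul_const _))
    (((htaylor.add hresidual).add hvariation).congr_left fun q => by
      simp only [map_sub, map_smul, add_sub_cancel]
      module)
  refine (hexpansion.comp_tendsto (k := fun i => (i, t₀ i + h i)) (tendsto_principal.2
    (.of_forall fun i => ⟨le_add_of_nonneg_right (hζ.step_mem i).1, le_rfl⟩))).congr_left
      fun i => ?_
  simp only [Function.comp_apply, add_sub_cancel_left, sub_self]
  module

end IsFlowFamily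

end Flow

/-! ### Comparison of heavy ball with its continuous model -/

section Comparison

variable {V : Type*} [NormedAddCommGroup V] [NormedSpace ℝ V] {v : V → V} {P Q : V →L[ℝ] V}
  {β K : ℝ}

/-- The vector field of the continuous model of `IsHeavyBall v P Q β h`. -/
def modifiedField (v : V → V) (P Q : V →L[ℝ] V) (β h : ℝ) (z : V) : V :=
  (1 - β)⁻¹ • v z
    + h • correction v P Q (-((1 + β) / 2) * (1 - β)⁻¹ ^ 3) ((1 - β)⁻¹ ^ 2) z

theorem IsBoundedC11.isBoundedLipschitz_modifiedField (hv : IsBoundedC11 v) (P Q : V →L[ℝ] V)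
    (β h : ℝ) : IsBoundedLipschitz (modifiedField v P Q β h) :=
  (hv.isBoundedLipschitz.const_smul _).add ((hv.isBoundedLipschitz_correction P Q _ _).const_smul h)

theorem transient_le {θ h : ℝ} {n : ℕ} (hθ : θ ∈ Ico 0 1) (hβ : |β| = θ ^ 4) (hh : 0 < h)
    (hn : 4 * Real.log h / Real.log |β| ≤ n) : (θ ^ 3) ^ (n + 1) ≤ h ^ 3 := by
  obtain rfl | hθ₀ := hθ.1.eq_or_lt
  · rw [zero_pow three_ne_zero, zero_pow n.succ_ne_zero]
    positivity
  have hlog : Real.log (θ ^ n) ≤ Real.log h := by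
    rw [hβ, Real.log_pow, Nat.cast_ofNat, mul_div_mul_left _ _ four_ne_zero,
      div_le_iff_of_neg (Real.log_neg hθ₀ hθ.2)] at hn
    rwa [Real.log_pow]
  have hθn : θ ^ n ≤ h := (Real.log_le_log_iff (pow_pos hθ₀ n) hh).1 hlog
  calc (θ ^ 3) ^ (n + 1) ≤ (θ ^ 3) ^ n :=
        pow_le_pow_of_le_one (by positivity) (pow_le_one₀ hθ.1 hθ.2.le) n.le_succ
    _ = (θ ^ n) ^ 3 := pow_right_comm ..
    _ ≤ h ^ 3 := by gcongr

/-- A heavy ball trajectory past the burn-in, together with a solution of the continuous model on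
one time step that agrees with it at the initial time. The components of the trajectory are shifted
by one against those of the paper, as in `IsHeavyBall`. -/
structure MatchedPair (v : V → V) (P Q : V →L[ℝ] V) (β K : ℝ) where
  h : ℝ
  z : ℕ → V
  n : ℕ
  ζ : ℝ → V
  step_mem : h ∈ Ioc 0 1
  isHeavyBall : IsHeavyBall v P Q β h z
  initial_le : ‖z 1 - z 0‖ ≤ K
  burnIn_le : 4 * Real.log h / Real.log |β| ≤ n
  hasDerivWithinAt : ∀ t ∈ Icc (n * h) (n * h + h),
    HasDerivWithinAt ζ (modifiedField v P Q β h (ζ t)) (Icc (n * h) (n * h + h)) t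
  matched : ζ (n * h) = z (n + 1)

namespace MatchedPair

theorem isHeavyBallFamily :
    IsHeavyBallFamily v P Q β (h : MatchedPair v P Q β K → ℝ) MatchedPair.z where
  step_mem m := Ioc_subset_Icc_self m.step_mem
  isHeavyBall := isHeavyBall
  initial_isBigO := isBigO_top.2 ⟨K, fun m => by simpa using m.initial_le⟩

theorem isFlowFamily :
    IsFlowFamily (fun z => (1 - β)⁻¹ • v z)
      (correction v P Q (-((1 + β) / 2) * (1 - β)⁻¹ ^ 3) ((1 - β)⁻¹ ^ 2))
      (h : MatchedPair v P Q β K → ℝ) (fun m => m.n * m.h) ζ where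
  step_mem m := Ioc_subset_Icc_self m.step_mem
  hasDerivWithinAt := hasDerivWithinAt

theorem secondResidual_isBigO (hv : IsBoundedC11 v) (hβ : |β| < 1) :
    (fun m : MatchedPair v P Q β K => secondResidual v P Q β m.h m.z (m.n + 1))
      =O[⊤] fun m => m.h ^ 3 := by
  obtain ⟨θ, hθ₀, hθ⟩ : ∃ θ : ℝ, 0 ≤ θ ∧ θ ^ 4 = |β| :=
    ⟨_, by positivity, Real.rpow_inv_natCast_pow (abs_nonneg β) four_ne_zero⟩
  have hθ₁ : θ < 1 := (pow_lt_one_iff_of_nonneg hθ₀ four_ne_zero).1 (hθ ▸ hβ)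
  refine ((isHeavyBallFamily.secondResidual_isBigO hv ⟨hθ₀, hθ₁⟩ hθ.symm).comp_tendsto
    (k := fun m => (m, m.n + 1)) (tendsto_top (l := ⊤))).trans (isBigO_top.2 ⟨2, fun m => ?_⟩)
  have hburn := transient_le ⟨hθ₀, hθ₁⟩ hθ.symm m.step_mem.1 m.burnIn_le
  have hh := m.step_mem.1
  simp only [Function.comp_apply, errorScale]
  rw [Real.norm_of_nonneg (by positivity), Real.norm_of_nonneg (by positivity)]
  linarith

theorem error_isBigO (hv : IsBoundedC11 v) (hβ : |β| < 1) :
    (fun m : MatchedPair v P Q β K => m.ζ (m.n * m.h + m.h) - m.z (m.n + 2))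
      =O[⊤] fun m => m.h ^ 3 := by
  have hβ' : 1 - β ≠ 0 := sub_ne_zero.2 (abs_lt.1 hβ).2.ne'
  have hflow := (isFlowFamily (K := K)).second_order_isBigO (hv.const_smul (1 - β)⁻¹)
    (hv.isBoundedLipschitz_correction P Q _ _)
  refine (hflow.sub (secondResidual_isBigO hv hβ)).congr_left fun m => ?_
  have hfderiv (z : V) : fderiv ℝ (fun z => (1 - β)⁻¹ • v z) z = (1 - β)⁻¹ • fderiv ℝ v z :=
    fderiv_fun_const_smul (hv.differentiable z) _
  have hcoeff (z : V) :
      correction v P Q (-((1 + β) / 2) * (1 - β)⁻¹ ^ 3) ((1 - β)⁻¹ ^ 2) z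
        + (2⁻¹ : ℝ) • fderiv ℝ (fun z => (1 - β)⁻¹ • v z) z ((1 - β)⁻¹ • v z)
      = correction v P Q (-β * (1 - β)⁻¹ ^ 3) ((1 - β)⁻¹ ^ 2) z := by
    simp only [correction, hfderiv, smul_apply, map_smul]
    match_scalars <;> field_simp; ring
  rw [hcoeff, m.matched, secondResidual, firstResidual]
  abel

end MatchedPair

end Comparison

theorem hasDerivWithinAt_prodMk_iff {V W : Type*} [NormedAddCommGroup V] [NormedSpace ℝ V]
    [NormedAddCommGroup W] [NormedSpace ℝ W] {x : ℝ → V} {y : ℝ → W} {d : V × W} {s : Set ℝ}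
    {t : ℝ} :
    HasDerivWithinAt (fun t => (x t, y t)) d s t ↔
      HasDerivWithinAt x d.1 s t ∧ HasDerivWithinAt y d.2 s t :=
  ⟨fun h => ⟨h.fst, h.snd⟩, fun h => h.1.prodMk h.2⟩

section LocallyCubicClose

variable {E F : Type*}
  [NormedAddCommGroup E] [InnerProductSpace ℝ E] [CompleteSpace E]
  [NormedAddCommGroup F] [InnerProductSpace ℝ F] [CompleteSpace F]

theorem locallyCubicClose_of_isHeavyBall {v : E × F → E × F} (hv : IsBoundedC11 v)
    (P Q : E × F →L[ℝ] E × F) {β : ℝ} (hβ : |β| < 1) (T : ℝ)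
    {flow : ℝ → (ℝ → E) → (ℝ → F) → Set ℝ → Prop} {discrete : ℝ → (ℤ → E) → (ℤ → F) → Prop}
    (hflow : ∀ h x y s, flow h x y s ↔ ∀ t ∈ s,
      HasDerivWithinAt (fun t => (x t, y t)) (modifiedField v P Q β h (x t, y t)) s t)
    (hdiscrete : ∀ h X Y, discrete h X Y →
      IsHeavyBall v P Q β h fun n => (X (n - 1), Y (n - 1))) :
    LocallyCubicClose flow discrete β T := by
  intro K
  obtain ⟨C, hC⟩ := isBigO_top.1 (MatchedPair.error_isBigO (P := P) (Q := Q) (K := K) hv hβ)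
  refine ⟨C, 1, one_pos, fun h hh₀ hh₁ => ⟨fun t₀ ht₀ a b => ?_, ?_⟩⟩
  · obtain ⟨z, hz₀, hz⟩ :=
      (hv.isBoundedLipschitz_modifiedField P Q β h).exists_solution ht₀ (a, b)
    exact ⟨fun t => (z t).1, fun t => (z t).2, (hflow _ _ _ _).2 hz,
      congrArg Prod.fst hz₀, congrArg Prod.snd hz₀⟩
  intro X Y hXY hX hY n hn _ x y hxy hx hy
  rw [add_one_mul, hflow] at hxy
  have herror := hC
    { h := h
      z := fun n => (X (n - 1), Y (n - 1))
      n := n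
      ζ := fun t => (x t, y t)
      step_mem := ⟨hh₀, hh₁.le⟩
      isHeavyBall := hdiscrete h X Y hXY
      initial_le := by simpa [Prod.norm_def] using ⟨hX, hY⟩
      burnIn_le := hn
      hasDerivWithinAt := hxy
      matched := by simp [hx, hy] }
  have hindex : ((n + 2 : ℕ) : ℤ) - 1 = n + 1 := by push_cast; ring
  simp only [hindex, norm_pow, Real.norm_of_nonneg hh₀.le, Prod.mk_sub_mk] at herror
  rw [add_one_mul]
  exact ⟨(norm_fst_le _).trans herror, (norm_snd_le _).trans herror⟩

end LocallyCubicClose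

/-! ### Descent-ascent fields -/

section SaddleField

variable {E F : Type*}
  [NormedAddCommGroup E] [InnerProductSpace ℝ E] [CompleteSpace E]
  [NormedAddCommGroup F] [InnerProductSpace ℝ F] [CompleteSpace F]

/-- The Riesz isomorphism `φ ↦ φ♯` of a real Hilbert space. Unlike `InnerProductSpace.toDual`, which
is semilinear for the trivial conjugation of `ℝ`, it is linear, so that it composes with
derivatives. -/
def riesz (E : Type*) [NormedAddCommGroup E] [InnerProductSpace ℝ E] [CompleteSpace E] :
    (E →L[ℝ] ℝ) →L[ℝ] E :=
  LinearMap.mkContinuous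
    { toFun := (InnerProductSpace.toDual ℝ E).symm
      map_add' := map_add _
      map_smul' := fun c φ => by simp } 1 (fun φ => by simp)

theorem inner_riesz (φ : E →L[ℝ] ℝ) (ξ : E) : ⟪riesz E φ, ξ⟫_ℝ = φ ξ :=
  InnerProductSpace.toDual_symm_apply

/-- Sends the differential of a function on `E × F` to its descent direction in `E` and its ascent
direction in `F`. -/
def saddle (E F : Type*)
    [NormedAddCommGroup E] [InnerProductSpace ℝ E] [CompleteSpace E]
    [NormedAddCommGroup F] [InnerProductSpace ℝ F] [CompleteSpace F] :
    (E × F →L[ℝ] ℝ) →L[ℝ] E × F :=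
  (-(riesz E ∘L (ContinuousLinearMap.compL ℝ E (E × F) ℝ).flip (.inl ℝ E F))).prod
    (riesz F ∘L (ContinuousLinearMap.compL ℝ F (E × F) ℝ).flip (.inr ℝ E F))

theorem inner_saddle_fst (φ : E × F →L[ℝ] ℝ) (ξ : E) : ⟪(saddle E F φ).1, ξ⟫_ℝ = -φ (ξ, 0) := by
  simp [saddle, inner_riesz]

theorem inner_saddle_snd (φ : E × F →L[ℝ] ℝ) (η : F) : ⟪(saddle E F φ).2, η⟫_ℝ = φ (0, η) := by
  simp [saddle, inner_riesz]

/-- The descent-ascent field of `f`. -/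
def saddleField (f : E → F → ℝ) (z : E × F) : E × F :=
  (-gradX f z.1 z.2, gradY f z.1 z.2)

variable {f : E → F → ℝ}

theorem saddleField_eq_of_hasFDerivAt {f' : E × F →L[ℝ] ℝ} {z : E × F}
    (hf : HasFDerivAt (Function.uncurry f) f' z) : saddleField f z = saddle E F f' := by
  have hx : HasFDerivAt (fun u => f u z.2) (f' ∘L .inl ℝ E F) z.1 :=
    HasFDerivAt.comp (f := fun u => (u, z.2)) z.1 hf (hasFDerivAt_prodMk_left (𝕜 := ℝ) z.1 z.2)
  have hy : HasFDerivAt (fun u => f z.1 u) (f' ∘L .inr ℝ E F) z.2 :=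
    HasFDerivAt.comp (f := fun u => (z.1, u)) z.2 hf (hasFDerivAt_prodMk_right (𝕜 := ℝ) z.1 z.2)
  refine Prod.ext (ext_inner_right ℝ fun ξ => ?_) (ext_inner_right ℝ fun η => ?_)
  · rw [inner_saddle_fst, saddleField, inner_neg_left, gradX, inner_gradient_left, hx.fderiv]
    simp
  · rw [inner_saddle_snd, saddleField, gradY, inner_gradient_left, hy.fderiv]
    simp

theorem saddleField_eq (hf : Differentiable ℝ (Function.uncurry f)) :
    saddleField f = fun z => saddle E F (fderiv ℝ (Function.uncurry f) z) :=
  funext fun z => saddleField_eq_of_hasFDerivAt (hf z).hasFDerivAt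

set_option maxSynthPendingDepth 3 in
theorem IsBoundedC11.fderiv_of_contDiff {V W : Type*} [NormedAddCommGroup V] [NormedSpace ℝ V]
    [NormedAddCommGroup W] [NormedSpace ℝ W] {g : V → W} (hg : ContDiff ℝ 3 g)
    (hbdd : ∀ k : ℕ, 1 ≤ k → k ≤ 3 → ∃ M : ℝ, ∀ z, ‖iteratedFDeriv ℝ k g z‖ ≤ M) :
    IsBoundedC11 (fderiv ℝ g) := by
  have hg₁ : ContDiff ℝ 2 (fderiv ℝ g) := hg.fderiv_right (by norm_num)
  have hg₂ : ContDiff ℝ 1 (fderiv ℝ (fderiv ℝ g)) := hg₁.fderiv_right (by norm_num)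
  obtain ⟨M₁, hM₁⟩ := hbdd 1 le_rfl (by norm_num)
  obtain ⟨M₂, hM₂⟩ := hbdd 2 (by norm_num) (by norm_num)
  obtain ⟨M₃, hM₃⟩ := hbdd 3 (by norm_num) le_rfl
  simp only [← norm_iteratedFDeriv_fderiv, norm_iteratedFDeriv_zero] at hM₁ hM₂ hM₃
  have h₁ : fderiv ℝ g =O[⊤] fun _ => (1 : ℝ) := isBigO_top.2 ⟨M₁, by simpa using hM₁⟩
  have h₂ : fderiv ℝ (fderiv ℝ g) =O[⊤] fun _ => (1 : ℝ) := isBigO_top.2 ⟨M₂, by simpa using hM₂⟩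
  have h₃ : fderiv ℝ (fderiv ℝ (fderiv ℝ g)) =O[⊤] fun _ => (1 : ℝ) :=
    isBigO_top.2 ⟨M₃, by simpa using hM₃⟩
  have hd₁ := hg₁.differentiable two_ne_zero
  exact ⟨hd₁, .of_fderiv hd₁ h₁ h₂, .of_fderiv (hg₂.differentiable one_ne_zero) h₂ h₃⟩

theorem isBoundedC11_saddleField (hf : ContDiff ℝ 3 (Function.uncurry f))
    (hbdd : ∀ k : ℕ, 1 ≤ k → k ≤ 3 →
      ∃ M : ℝ, ∀ z, ‖iteratedFDeriv ℝ k (Function.uncurry f) z‖ ≤ M) :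
    IsBoundedC11 (saddleField f) :=
  saddleField_eq (hf.differentiable three_ne_zero) ▸
    (IsBoundedC11.fderiv_of_contDiff hf hbdd).clm_comp (saddle E F)

end SaddleField

section ModifiedLoss

variable {E F : Type*}
  [NormedAddCommGroup E] [InnerProductSpace ℝ E] [CompleteSpace E]
  [NormedAddCommGroup F] [InnerProductSpace ℝ F] [CompleteSpace F] {f : E → F → ℝ}

/-- The projection of `E × F` onto its first factor, as an endomorphism of `E × F`. -/
def projFst (E F : Type*) [NormedAddCommGroup E] [NormedSpace ℝ E]
    [NormedAddCommGroup F] [NormedSpace ℝ F] : E × F →L[ℝ] E × F :=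
  .inl ℝ E F ∘L .fst ℝ E F

/-- The projection of `E × F` onto its second factor, as an endomorphism of `E × F`. -/
def projSnd (E F : Type*) [NormedAddCommGroup E] [NormedSpace ℝ E]
    [NormedAddCommGroup F] [NormedSpace ℝ F] : E × F →L[ℝ] E × F :=
  .inr ℝ E F ∘L .snd ℝ E F

theorem hasFDerivAt_saddleField (hf : ContDiff ℝ 2 (Function.uncurry f)) (z : E × F) :
    HasFDerivAt (saddleField f) (saddle E F ∘L fderiv ℝ (fderiv ℝ (Function.uncurry f)) z) z := by
  have hf₁ : ContDiff ℝ 1 (fderiv ℝ (Function.uncurry f)) := hf.fderiv_right (by norm_num)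
  rw [saddleField_eq (hf.differentiable two_ne_zero)]
  exact (saddle E F).hasFDerivAt.comp z (hf₁.differentiable one_ne_zero z).hasFDerivAt

theorem saddle_fderiv_fderiv (hf : ContDiff ℝ 2 (Function.uncurry f)) (z δ : E × F) :
    saddle E F (fderiv ℝ (fderiv ℝ (Function.uncurry f)) z δ) = fderiv ℝ (saddleField f) z δ := by
  rw [(hasFDerivAt_saddleField hf z).fderiv, ContinuousLinearMap.comp_apply]

theorem hasFDerivAt_norm_gradX_sq (hf : ContDiff ℝ 2 (Function.uncurry f)) (z : E × F) :
    HasFDerivAt (fun z : E × F => ‖gradX f z.1 z.2‖ ^ 2)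
      ((-2 : ℝ) • fderiv ℝ (fderiv ℝ (Function.uncurry f)) z (projFst E F (saddleField f z)))
      z := by
  have hsq := ((ContinuousLinearMap.fst ℝ E F).hasFDerivAt.comp z
    (hasFDerivAt_saddleField hf z)).norm_sq
  simp only [Function.comp_def, ContinuousLinearMap.coe_fst', saddleField, norm_neg] at hsq
  refine hsq.congr_fderiv (ContinuousLinearMap.ext fun δ => ?_)
  have hsymm := (hf.contDiffAt (x := z)).isSymmSndFDerivAt (by simp)
  have hinner : ⟪-gradX f z.1 z.2,
        (saddle E F (fderiv ℝ (fderiv ℝ (Function.uncurry f)) z δ)).1⟫_ℝ =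
      -fderiv ℝ (fderiv ℝ (Function.uncurry f)) z (projFst E F (saddleField f z)) δ := by
    rw [real_inner_comm, inner_saddle_fst, hsymm.eq]
    rfl
  simpa using hinner

theorem hasFDerivAt_norm_gradY_sq (hf : ContDiff ℝ 2 (Function.uncurry f)) (z : E × F) :
    HasFDerivAt (fun z : E × F => ‖gradY f z.1 z.2‖ ^ 2)
      ((2 : ℝ) • fderiv ℝ (fderiv ℝ (Function.uncurry f)) z (projSnd E F (saddleField f z)))
      z := by
  have hsq := ((ContinuousLinearMap.snd ℝ E F).hasFDerivAt.comp z
    (hasFDerivAt_saddleField hf z)).norm_sq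
  simp only [Function.comp_def, ContinuousLinearMap.coe_snd', saddleField] at hsq
  refine hsq.congr_fderiv (ContinuousLinearMap.ext fun δ => ?_)
  have hsymm := (hf.contDiffAt (x := z)).isSymmSndFDerivAt (by simp)
  have hinner : ⟪gradY f z.1 z.2,
        (saddle E F (fderiv ℝ (fderiv ℝ (Function.uncurry f)) z δ)).2⟫_ℝ =
      fderiv ℝ (fderiv ℝ (Function.uncurry f)) z (projSnd E F (saddleField f z)) δ := by
    rw [real_inner_comm, inner_saddle_snd, hsymm.eq]
    rfl
  simpa using hinner

theorem hasFDerivAt_modifiedLoss (hf : ContDiff ℝ 2 (Function.uncurry f)) (β h : ℝ) (z : E × F) :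
    HasFDerivAt (Function.uncurry (modifiedLoss f β h))
      ((1 / (1 - β)) • fderiv ℝ (Function.uncurry f) z
        - (h * (1 + β) / (2 * (1 - β) ^ 3)) •
          fderiv ℝ (fderiv ℝ (Function.uncurry f)) z (saddleField f z)) z := by
  have hloss := (hf.differentiable two_ne_zero z).hasFDerivAt.const_mul (1 / (1 - β))
  have hsq := ((hasFDerivAt_norm_gradX_sq hf z).sub (hasFDerivAt_norm_gradY_sq hf z)).const_mul
    (h * (1 + β) / (4 * (1 - β) ^ 3))
  refine (hloss.add hsq).congr_fderiv ?_
  have hsplit :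
      saddleField f z = projFst E F (saddleField f z) + projSnd E F (saddleField f z) := by
    simp [projFst, projSnd]
  conv_rhs => rw [hsplit, map_add]
  generalize 1 - β = c
  module

theorem saddleField_modifiedLoss (hf : ContDiff ℝ 2 (Function.uncurry f)) (P : E × F →L[ℝ] E × F)
    (β h : ℝ) : saddleField (modifiedLoss f β h) = modifiedField (saddleField f) P 0 β h := by
  funext z
  rw [saddleField_eq_of_hasFDerivAt (hasFDerivAt_modifiedLoss hf β h z), map_sub, map_smul,
    map_smul, saddle_fderiv_fderiv hf,
    ← saddleField_eq_of_hasFDerivAt (hf.differentiable two_ne_zero z).hasFDerivAt]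
  simp only [modifiedField, correction, zero_apply, smul_zero, add_zero]
  generalize 1 - β = c
  match_scalars <;> ring

theorem saddleField_modifiedLoss_sub (hf : ContDiff ℝ 2 (Function.uncurry f)) (β h : ℝ)
    (z : E × F) :
    saddleField (fun x y => modifiedLoss f β h x y - h / (2 * (1 - β) ^ 2) * ‖gradX f x y‖ ^ 2) z =
      saddleField (modifiedLoss f β h) z + (h * (1 - β)⁻¹ ^ 2) •
        fderiv ℝ (saddleField f) z (projFst E F (saddleField f z)) := by
  have hloss := hasFDerivAt_modifiedLoss hf β h z
  have hsub := hloss.sub ((hasFDerivAt_norm_gradX_sq hf z).const_mul (h / (2 * (1 - β) ^ 2)))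
  rw [saddleField_eq_of_hasFDerivAt hloss, saddleField_eq_of_hasFDerivAt hsub, map_sub, smul_smul,
    map_smul, saddle_fderiv_fderiv hf]
  generalize 1 - β = c
  module

theorem isContinuousSimHB_iff (hf : ContDiff ℝ 2 (Function.uncurry f)) (P : E × F →L[ℝ] E × F)
    (β h : ℝ) (x : ℝ → E) (y : ℝ → F) (s : Set ℝ) :
    IsContinuousSimHB f β h x y s ↔ ∀ t ∈ s, HasDerivWithinAt (fun t => (x t, y t))
      (modifiedField (saddleField f) P 0 β h (x t, y t)) s t := by
  simp only [hasDerivWithinAt_prodMk_iff, ← saddleField_modifiedLoss hf]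
  rfl

theorem isContinuousAltHB_iff (hf : ContDiff ℝ 2 (Function.uncurry f)) (β h : ℝ) (x : ℝ → E)
    (y : ℝ → F) (s : Set ℝ) :
    IsContinuousAltHB f β h x y s ↔ ∀ t ∈ s, HasDerivWithinAt (fun t => (x t, y t))
      (modifiedField (saddleField f) (projFst E F) (projSnd E F) β h (x t, y t)) s t := by
  have hfst (z : E × F) :
      (modifiedField (saddleField f) (projFst E F) (projSnd E F) β h z).1 =
        -gradX (modifiedLoss f β h) z.1 z.2 := by
    change _ = (saddleField (modifiedLoss f β h) z).1
    rw [saddleField_modifiedLoss hf (projFst E F)]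
    simp [modifiedField, correction, projSnd]
  have hsnd (z : E × F) :
      (modifiedField (saddleField f) (projFst E F) (projSnd E F) β h z).2 =
        gradY (fun u v => modifiedLoss f β h u v - h / (2 * (1 - β) ^ 2) * ‖gradX f u v‖ ^ 2)
          z.1 z.2 := by
    change _ = (saddleField (fun u v => modifiedLoss f β h u v
      - h / (2 * (1 - β) ^ 2) * ‖gradX f u v‖ ^ 2) z).2
    rw [saddleField_modifiedLoss_sub hf, saddleField_modifiedLoss hf (projFst E F)]
    simp only [modifiedField, correction, projSnd, ContinuousLinearMap.comp_apply,
      ContinuousLinearMap.coe_snd', ContinuousLinearMap.inr_apply, zero_apply, Prod.snd_add,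
      Prod.smul_snd, Prod.snd_zero]
    module
  simp only [hasDerivWithinAt_prodMk_iff, hfst, hsnd]
  rfl

theorem IsSimHB.isHeavyBall {β h : ℝ} {X : ℤ → E} {Y : ℤ → F} (hXY : IsSimHB f β h X Y)
    (P : E × F →L[ℝ] E × F) :
    IsHeavyBall (saddleField f) P 0 β h fun n => (X (n - 1), Y (n - 1)) := by
  intro n
  obtain ⟨hX, hY⟩ := hXY n
  have hindex₁ : ((n + 1 : ℕ) : ℤ) - 1 = n := by simp
  have hindex₂ : ((n + 2 : ℕ) : ℤ) - 1 = n + 1 := by grind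
  simp only [hindex₁, hindex₂, hX, hY, saddleField]
  ext
  · simp
    module
  · simp
    module

theorem IsAltHB.isHeavyBall {β h : ℝ} {X : ℤ → E} {Y : ℤ → F} (hXY : IsAltHB f β h X Y) :
    IsHeavyBall (saddleField f) (projFst E F) (projSnd E F) β h
      fun n => (X (n - 1), Y (n - 1)) := by
  intro n
  obtain ⟨hX, hY⟩ := hXY n
  have hindex₁ : ((n + 1 : ℕ) : ℤ) - 1 = n := by simp
  have hindex₂ : ((n + 2 : ℕ) : ℤ) - 1 = n + 1 := by grind
  have hpoint : (X n, Y n) + projFst E F ((X (n + 1), Y (n + 1)) - (X n, Y n)) =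
      (X (n + 1), Y n) := by
    simp [projFst]
  simp only [hindex₁, hindex₂, hpoint, saddleField]
  ext
  · simp [projSnd, hX]
    module
  · simp [projSnd, hY]
    module

end ModifiedLoss

end HeavyBall

end

theorem theorem3p1_general {E F : Type*}
    [NormedAddCommGroup E] [InnerProductSpace ℝ E] [CompleteSpace E]
    [NormedAddCommGroup F] [InnerProductSpace ℝ F] [CompleteSpace F]
    (f : E → F → ℝ) (hf : ContDiff ℝ 3 (Function.uncurry f))
    (hbdd : ∀ k : ℕ, 1 ≤ k → k ≤ 3 →
      ∃ M : ℝ, ∀ z, ‖iteratedFDeriv ℝ k (Function.uncurry f) z‖ ≤ M)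
    (β : ℝ) (hβ : |β| < 1) (T : ℝ) :
    HeavyBall.LocallyCubicClose (HeavyBall.IsContinuousSimHB f β) (HeavyBall.IsSimHB f β) β T ∧
    HeavyBall.LocallyCubicClose (HeavyBall.IsContinuousAltHB f β) (HeavyBall.IsAltHB f β) β T := by
  have hv := HeavyBall.isBoundedC11_saddleField hf hbdd
  have hf₂ : ContDiff ℝ 2 (Function.uncurry f) := hf.of_le (by norm_num)
  exact ⟨HeavyBall.locallyCubicClose_of_isHeavyBall hv 0 0 hβ T
      (HeavyBall.isContinuousSimHB_iff hf₂ 0 β) fun _ _ _ hXY => hXY.isHeavyBall 0,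
    HeavyBall.locallyCubicClose_of_isHeavyBall hv (HeavyBall.projFst E F) (HeavyBall.projSnd E F)
      hβ T (HeavyBall.isContinuousAltHB_iff hf₂ β) fun _ _ _ hXY => hXY.isHeavyBall⟩

theorem theorem3p1 {p q : ℕ}
    (f : EuclideanSpace ℝ (Fin p) → EuclideanSpace ℝ (Fin q) → ℝ)
    (hf : ContDiff ℝ 4 (Function.uncurry f))
    (hbdd : ∀ k : ℕ, 1 ≤ k → k ≤ 4 →
      ∃ M : ℝ, ∀ z, ‖iteratedFDeriv ℝ k (Function.uncurry f) z‖ ≤ M)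
    (β : ℝ) (hβ : |β| < 1) (T : ℝ) (hT : 0 < T) :
    HeavyBall.LocallyCubicClose (HeavyBall.IsContinuousSimHB f β) (HeavyBall.IsSimHB f β) β T ∧
    HeavyBall.LocallyCubicClose (HeavyBall.IsContinuousAltHB f β) (HeavyBall.IsAltHB f β) β T :=
  theorem3p1_general f (hf.of_le (by norm_num)) (fun k h₁ h₃ => hbdd k h₁ (by lia)) β hβ T
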